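/- Let $N>1$ be an odd integer, let $b,c\in\mathbb R$ with $c\neq 0$, and let $g:\mathbb Z^+\times\mathbb R\to\mathbb R$ (with $\mathbb Z^+=\{0,1,2,\dots\}$) be continuous and $N$-periodic in its first argument. Notation. Let $A=\begin{pmatrix}0&1\\-c&-b\end{pmatrix}$, and let $X_N$ be the space of $N$-periodic functions $x:\mathbb Z^+\to\mathbb R^2$ with the norm $\|x\|=\sup_t|x(t)|$, where $|\cdot|$ is the Euclidean norm. Define $\mathcal L:X_N\to X_N$ by $(\mathcal Lx)(t)=x(t+1)-Ax(t)$. Let $V$ be the orthogonal projection of $\mathbb R^2$ onto $\operatorname{Ker}(I-A^N)$ and define $P:X_N\to X_N$ by $(Px)(t)=A^tVx(0)$; this is a projection onto $\operatorname{Ker}\mathcal L$. Let $W$ be a matrix whose columns form a basis of $\operatorname{Ker}\big((I-A^N)^T\big)$, put $\Psi(t)=(A^{-t})^T(A^N)^TW$, and define $Q:X_N\to X_N$ by $$(Qh)(t)=\Psi(t+1)\Big(\sum_{j=0}^{N-1}\Psi(j)^T\Psi(j)\Big)^{-1}\sum_{i=0}^{N-1}\Psi(i+1)^Th(i)$$ ($Q=0$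 if that kernel is trivial); this is a projection with $\operatorname{Ker}Q=\operatorname{Im}\mathcal L$. Finally let $M_p:\operatorname{Im}\mathcal L\to\operatorname{Ker}P$ be the inverse of the restriction of $\mathcal L$ to $\operatorname{Ker}P$, and let $\|M_p(I-Q)\|$ be the operator norm of $M_p(I-Q):X_N\to X_N$. **Theorem.** Let $r,\hat z,\delta$ be positive constants such that - (C1) $|g(t,x)|\le\delta$ for all $t\in\mathbb Z^+$ and all $x\in[-2r,2r]$; - (C2) $x\,g(t,x)>0$ for all $t\in\mathbb Z^+$ and all $x$ with $|x|>\hat z$; - (C3) $\hat z+\|M_p(I-Q)\|\,\delta<r$; - (C4) if $N\arccos(-b/2)$ is an integer multiple of $2\pi$, then $c\neq1$ or $|b|\ge2$ (for $|b|>2$ the condition (C4) is regarded as satisfied). Then there is an $N$-periodic $y:\mathbb Z^+\to\mathbb R$ with $$y(t+2)+b\,y(t+1)+c\,y(t)=g(t,y(t))\qquad\text{for all }t\in\mathbb Z^+.$$ -/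

import Mathlib

open scoped Matrix BoundedContinuousFunction

noncomputable section

namespace PeriodicDifference

/-- `ℝ²` with the Euclidean norm. -/
abbrev Plane : Type := EuclideanSpace ℝ (Fin 2)

/-- The `2 × 2` companion matrix of `y(t+2) + b y(t+1) + c y(t)`. -/
def companion (b c : ℝ) : Matrix (Fin 2) (Fin 2) ℝ :=
  !![0, 1; -c, -b]

lemma isUnit_companion (b : ℝ) {c : ℝ} (hc : c ≠ 0) : IsUnit (companion b c).det := by
  simpa [companion, Matrix.det_fin_two] using hc

/-- The `N`-periodic functions, as a subspace of the bounded functions from `{0, 1, 2, …}` to `ℝ²`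
(for `N ≥ 1` every `N`-periodic function is bounded, see `PeriodicSpace.mk`). -/
def periodicSubmodule (N : ℕ) : Submodule ℝ (ℕ →ᵇ Plane) where
  carrier := {φ | Function.Periodic φ N}
  add_mem' {φ ψ} hφ hψ := fun t => by
    simp only [BoundedContinuousFunction.coe_add, Pi.add_apply, hφ t, hψ t]
  zero_mem' := fun t => rfl
  smul_mem' a φ hφ := fun t => by
    simp only [BoundedContinuousFunction.coe_smul, hφ t]

/-- The space `X_N` of `N`-periodic functions from `{0, 1, 2, …}` to `ℝ²`, with the supremum norm
`‖φ‖ = sup_t |φ(t)|`, where `|·|` is the Euclidean norm. -/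
def PeriodicSpace (N : ℕ) : Type := periodicSubmodule N

instance (N : ℕ) : NormedAddCommGroup (PeriodicSpace N) :=
  inferInstanceAs (NormedAddCommGroup (periodicSubmodule N))

instance (N : ℕ) : NormedSpace ℝ (PeriodicSpace N) :=
  inferInstanceAs (NormedSpace ℝ (periodicSubmodule N))

instance (N : ℕ) : FunLike (PeriodicSpace N) ℕ Plane where
  coe x := let φ : periodicSubmodule N := x; fun t => φ.1 t
  coe_injective _ _ h := Subtype.ext (DFunLike.coe_injective h)

lemma PeriodicSpace.periodic {N : ℕ} (x : PeriodicSpace N) (t : ℕ) : x (t + N) = x t := x.2 t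

@[simp]
lemma PeriodicSpace.add_apply {N : ℕ} (x y : PeriodicSpace N) (t : ℕ) :
    (x + y) t = x t + y t := rfl

@[simp]
lemma PeriodicSpace.smul_apply {N : ℕ} (a : ℝ) (x : PeriodicSpace N) (t : ℕ) :
    (a • x) t = a • x t := rfl

lemma norm_le_sum_of_periodic {N : ℕ} [NeZero N] {φ : ℕ → Plane} (h : Function.Periodic φ N)
    (t : ℕ) : ‖φ t‖ ≤ ∑ i ∈ Finset.range N, ‖φ i‖ := by
  rw [← h.map_mod_nat t]
  exact Finset.single_le_sum (f := fun i => ‖φ i‖) (fun i _ => norm_nonneg _)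
    (Finset.mem_range.2 (Nat.mod_lt _ (NeZero.pos N)))

/-- An `N`-periodic function as an element of `X_N`. -/
def PeriodicSpace.mk {N : ℕ} [NeZero N] (φ : ℕ → Plane) (h : Function.Periodic φ N) :
    PeriodicSpace N :=
  ⟨BoundedContinuousFunction.ofNormedAddCommGroupDiscrete φ (∑ i ∈ Finset.range N, ‖φ i‖)
    (norm_le_sum_of_periodic h), h⟩

@[simp]
lemma PeriodicSpace.mk_apply {N : ℕ} [NeZero N] (φ : ℕ → Plane) (h : Function.Periodic φ N)
    (t : ℕ) : PeriodicSpace.mk φ h t = φ t := rfl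

lemma PeriodicSpace.ext {N : ℕ} {x y : PeriodicSpace N} (h : ∀ t, x t = y t) : x = y :=
  DFunLike.ext x y h

instance PeriodicSpace.finiteDimensional (N : ℕ) [NeZero N] :
    FiniteDimensional ℝ (PeriodicSpace N) := by
  let e : PeriodicSpace N →ₗ[ℝ] (Fin N → Plane) :=
    { toFun := fun x i => x i
      map_add' := fun _ _ => rfl
      map_smul' := fun _ _ => rfl }
  refine Module.Finite.of_injective e fun x y hxy => PeriodicSpace.ext fun t => ?_
  have h := congrFun hxy ⟨t % N, Nat.mod_lt _ (NeZero.pos N)⟩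
  have hx : x (t % N) = x t := Function.Periodic.map_mod_nat x.2 t
  have hy : y (t % N) = y t := Function.Periodic.map_mod_nat y.2 t
  rw [← hx, ← hy]
  exact h

/-- The operator `(𝓛 x)(t) = x(t+1) - A x(t)` on `X_N`. -/
def linearOp (b c : ℝ) (N : ℕ) [NeZero N] : PeriodicSpace N →ₗ[ℝ] PeriodicSpace N where
  toFun x := PeriodicSpace.mk (fun t => x (t + 1) - (companion b c).toEuclideanLin (x t))
    (fun t => by
      have h := x.periodic (t + 1)
      rw [show t + 1 + N = t + N + 1 by ring] at h
      simp only [h, x.periodic t])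
  map_add' x y := PeriodicSpace.ext fun t => by
    change (x + y) (t + 1) - (companion b c).toEuclideanLin ((x + y) t) =
      (x (t + 1) - (companion b c).toEuclideanLin (x t)) +
        (y (t + 1) - (companion b c).toEuclideanLin (y t))
    simp only [PeriodicSpace.add_apply, map_add]
    abel
  map_smul' a x := PeriodicSpace.ext fun t => by
    change (a • x) (t + 1) - (companion b c).toEuclideanLin ((a • x) t) =
      a • (x (t + 1) - (companion b c).toEuclideanLin (x t))
    simp only [PeriodicSpace.smul_apply, map_smul, smul_sub]

lemma linearOp_apply (b c : ℝ) (N : ℕ) [NeZero N] (x : PeriodicSpace N) (t : ℕ) :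
    linearOp b c N x t = x (t + 1) - (companion b c).toEuclideanLin (x t) := rfl

/-- The subspace `Ker(I - A^N)` of `ℝ²`. -/
def rightKer (b c : ℝ) (N : ℕ) : Submodule ℝ Plane :=
  LinearMap.ker (Matrix.toEuclideanLin (1 - companion b c ^ N))

lemma mem_rightKer {b c : ℝ} {N : ℕ} {v : Plane} :
    v ∈ rightKer b c N ↔ (companion b c ^ N).toEuclideanLin v = v := by
  rw [rightKer, LinearMap.mem_ker, map_sub, LinearMap.sub_apply, sub_eq_zero, Matrix.toLpLin_one,
    LinearMap.id_apply, eq_comm]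

/-- The projection `(P x)(t) = A^t V x(0)`, where `V` is the orthogonal projection of `ℝ²` onto
`Ker(I - A^N)`. -/
def projP (b c : ℝ) (N : ℕ) [NeZero N] : PeriodicSpace N →ₗ[ℝ] PeriodicSpace N where
  toFun x := PeriodicSpace.mk
    (fun t => (companion b c ^ t).toEuclideanLin ((rightKer b c N).starProjection (x 0)))
    (fun t => by
      have h : (rightKer b c N).starProjection (x 0) ∈ rightKer b c N :=
        Submodule.starProjection_apply_mem _ _
      rw [mem_rightKer] at h
      simp only [pow_add, Matrix.toLpLin_mul_same, LinearMap.comp_apply, h])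
  map_add' x y := PeriodicSpace.ext fun t => by simp
  map_smul' a x := PeriodicSpace.ext fun t => by simp

lemma projP_apply (b c : ℝ) (N : ℕ) [NeZero N] (x : PeriodicSpace N) (t : ℕ) :
    projP b c N x t =
      (companion b c ^ t).toEuclideanLin ((rightKer b c N).starProjection (x 0)) := rfl

/-- The subspace `Ker((I - A^N)ᵀ)` of `ℝ²`. -/
def leftKer (b c : ℝ) (N : ℕ) : Submodule ℝ (Fin 2 → ℝ) :=
  LinearMap.ker (1 - companion b c ^ N)ᵀ.mulVecLin

section Projections

variable {b c : ℝ} {N k : ℕ}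

/-- The matrix `W` whose columns are the vectors of a given basis of `Ker((I - A^N)ᵀ)`. -/
def basisMatrix (w : Module.Basis (Fin k) ℝ (leftKer b c N)) : Matrix (Fin 2) (Fin k) ℝ :=
  Matrix.of fun i j => (w j : Fin 2 → ℝ) i

/-- `Ψ(t) = (A^{-t})ᵀ (A^N)ᵀ W`; its columns span the `N`-periodic solutions of the adjoint
problem `x(t+1) = A^{-T} x(t)`. -/
def Psi (w : Module.Basis (Fin k) ℝ (leftKer b c N)) (t : ℕ) : Matrix (Fin 2) (Fin k) ℝ :=
  ((companion b c ^ t)⁻¹)ᵀ * (companion b c ^ N)ᵀ * basisMatrix w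

/-- The Gram matrix `∑_{j<N} Ψ(j)ᵀ Ψ(j)`; if `Ψ` has one column, this is the number
`∑_{j<N} |Ψ(j)|²`. -/
def gram (w : Module.Basis (Fin k) ℝ (leftKer b c N)) : Matrix (Fin k) (Fin k) ℝ :=
  ∑ j ∈ Finset.range N, (Psi w j)ᵀ * Psi w j

/-- The functional `h ↦ ∑_{i<N} Ψ(i+1)ᵀ h(i)`. -/
def moment (w : Module.Basis (Fin k) ℝ (leftKer b c N)) :
    PeriodicSpace N →ₗ[ℝ] (Fin k → ℝ) where
  toFun h := ∑ i ∈ Finset.range N, (Psi w (i + 1))ᵀ *ᵥ (h i).ofLp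
  map_add' x y := by simp [Matrix.mulVec_add, Finset.sum_add_distrib]
  map_smul' a x := by simp [Matrix.mulVec_smul, Finset.smul_sum]

lemma moment_apply (w : Module.Basis (Fin k) ℝ (leftKer b c N)) (h : PeriodicSpace N) :
    moment w h = ∑ i ∈ Finset.range N, (Psi w (i + 1))ᵀ *ᵥ (h i).ofLp := rfl

lemma transpose_mul_basisMatrix (w : Module.Basis (Fin k) ℝ (leftKer b c N)) :
    (companion b c ^ N)ᵀ * basisMatrix w = basisMatrix w := by
  ext i j
  have h : (1 - companion b c ^ N)ᵀ *ᵥ (w j : Fin 2 → ℝ) = 0 := (w j).2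
  rw [Matrix.transpose_sub, Matrix.transpose_one, Matrix.sub_mulVec, Matrix.one_mulVec,
    sub_eq_zero] at h
  exact (congrFun h i).symm

lemma Psi_periodic (hc : c ≠ 0) (w : Module.Basis (Fin k) ℝ (leftKer b c N)) :
    Function.Periodic (Psi w) N := fun t => by
  have hN : IsUnit (companion b c ^ N).det := by
    rw [Matrix.det_pow]; exact (isUnit_companion b hc).pow N
  have h1 : ((companion b c ^ N)⁻¹)ᵀ * (companion b c ^ N)ᵀ = 1 := by
    rw [← Matrix.transpose_mul, Matrix.mul_nonsing_inv _ hN, Matrix.transpose_one]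
  rw [Psi, Psi, Matrix.mul_assoc, Matrix.mul_assoc, transpose_mul_basisMatrix, pow_add,
    Matrix.mul_inv_rev, Matrix.transpose_mul, Matrix.mul_assoc]
  congr 1
  rw [← transpose_mul_basisMatrix w, ← Matrix.mul_assoc]
  nth_rewrite 1 [h1]
  rw [Matrix.one_mul, transpose_mul_basisMatrix]

/-- The projection `Q` on `X_N`,
`(Q h)(t) = Ψ(t+1) (∑_{j<N} Ψ(j)ᵀΨ(j))⁻¹ ∑_{i<N} Ψ(i+1)ᵀ h(i)`, whose kernel is `Im 𝓛`. -/
def projQ [NeZero N] (hc : c ≠ 0) (w : Module.Basis (Fin k) ℝ (leftKer b c N)) :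
    PeriodicSpace N →ₗ[ℝ] PeriodicSpace N where
  toFun h := PeriodicSpace.mk
    (fun t => WithLp.toLp 2 (Psi w (t + 1) *ᵥ ((gram w)⁻¹ *ᵥ moment w h)))
    (fun t => by
      have h := Psi_periodic hc w (t + 1)
      rw [show t + 1 + N = t + N + 1 by ring] at h
      simp only [h])
  map_add' x y := PeriodicSpace.ext fun t => by simp [Matrix.mulVec_add]
  map_smul' a x := PeriodicSpace.ext fun t => by simp [Matrix.mulVec_smul]

lemma projQ_apply [NeZero N] (hc : c ≠ 0) (w : Module.Basis (Fin k) ℝ (leftKer b c N))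
    (h : PeriodicSpace N) (t : ℕ) : projQ hc w h t =
      WithLp.toLp 2 (Psi w (t + 1) *ᵥ ((gram w)⁻¹ *ᵥ moment w h)) := rfl

lemma gram_eq (hc : c ≠ 0) (w : Module.Basis (Fin k) ℝ (leftKer b c N)) :
    gram w = ∑ j ∈ Finset.range N, (Psi w (j + 1))ᵀ * Psi w (j + 1) := by
  have h1 := Finset.sum_range_succ (fun j => (Psi w j)ᵀ * Psi w j) N
  have h2 := Finset.sum_range_succ' (fun j => (Psi w j)ᵀ * Psi w j) N
  have h0 : Psi w N = Psi w 0 := by simpa using Psi_periodic hc w 0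
  rw [h0] at h1
  exact add_right_cancel (h1.symm.trans h2)

lemma basisMatrix_injective (w : Module.Basis (Fin k) ℝ (leftKer b c N)) (u : Fin k → ℝ)
    (hu : basisMatrix w *ᵥ u = 0) : u = 0 := by
  have h : ∑ j, u j • w j = 0 := by
    apply Subtype.ext
    funext i
    have := congrFun hu i
    simp only [Matrix.mulVec, dotProduct, basisMatrix, Matrix.of_apply] at this
    simpa [mul_comm] using this
  funext j
  exact Fintype.linearIndependent_iff.1 w.linearIndependent u h j

lemma isUnit_gram [NeZero N] (w : Module.Basis (Fin k) ℝ (leftKer b c N)) :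
    IsUnit (gram w).det := by
  rw [← Matrix.isUnit_iff_isUnit_det, ← Matrix.mulVec_injective_iff_isUnit]
  refine (injective_iff_map_eq_zero (gram w).mulVecLin).2 fun u hu => ?_
  have hu : gram w *ᵥ u = 0 := hu
  have h : ∑ j ∈ Finset.range N, (Psi w j *ᵥ u) ⬝ᵥ (Psi w j *ᵥ u) = 0 := by
    have h' : u ⬝ᵥ (gram w *ᵥ u) = 0 := by rw [hu]; simp
    rw [gram, Matrix.sum_mulVec, dotProduct_sum] at h'
    rw [← h']
    refine Finset.sum_congr rfl fun j _ => ?_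
    rw [← Matrix.mulVec_mulVec, Matrix.dotProduct_mulVec u, Matrix.vecMul_transpose]
  have h0 := (Finset.sum_eq_zero_iff_of_nonneg (fun j _ => by
    simpa using dotProduct_star_self_nonneg (Psi w j *ᵥ u))).1 h 0
      (Finset.mem_range.2 (NeZero.pos N))
  have h0 : Psi w 0 *ᵥ u = 0 := dotProduct_self_eq_zero.1 h0
  apply basisMatrix_injective w
  rwa [Psi, Matrix.mul_assoc, transpose_mul_basisMatrix, pow_zero, inv_one, Matrix.transpose_one,
    Matrix.one_mul] at h0

lemma exists_of_basisMatrix_eq_zero (w : Module.Basis (Fin k) ℝ (leftKer b c N))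
    (v : Fin 2 → ℝ) (hv : (basisMatrix w)ᵀ *ᵥ v = 0) :
    ∃ x₀ : Fin 2 → ℝ, (1 - companion b c ^ N) *ᵥ x₀ = v := by
  have hT := Matrix.toEuclideanLin_conjTranspose_eq_adjoint (1 - companion b c ^ N)
  have ho := LinearMap.orthogonal_ker (1 - companion b c ^ N).toEuclideanLin.adjoint
  rw [LinearMap.adjoint_adjoint] at ho
  have hmem : WithLp.toLp 2 v ∈ LinearMap.range (1 - companion b c ^ N).toEuclideanLin := by
    rw [← ho, Submodule.mem_orthogonal]
    intro u hu
    have hu' : u.ofLp ∈ leftKer b c N := by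
      rw [← hT, LinearMap.mem_ker] at hu
      exact congrArg WithLp.ofLp hu
    have hsum : ((∑ j, w.repr ⟨u.ofLp, hu'⟩ j • w j : leftKer b c N) : Fin 2 → ℝ) = u.ofLp :=
      congrArg Subtype.val (w.sum_repr ⟨u.ofLp, hu'⟩)
    simp only [Submodule.coe_sum, Submodule.coe_smul] at hsum
    have hdot : ∀ j, (w j : Fin 2 → ℝ) ⬝ᵥ v = 0 := fun j => congrFun hv j
    have h0 : u.ofLp ⬝ᵥ v = 0 := by
      calc u.ofLp ⬝ᵥ v = (∑ j, w.repr ⟨u.ofLp, hu'⟩ j • (w j : Fin 2 → ℝ)) ⬝ᵥ v := by rw [hsum]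
        _ = 0 := by simp only [sum_dotProduct, smul_dotProduct, hdot, smul_zero,
            Finset.sum_const_zero]
    rw [EuclideanSpace.inner_eq_star_dotProduct]
    simpa [dotProduct_comm] using h0
  obtain ⟨x₀, hx₀⟩ := hmem
  exact ⟨x₀.ofLp, congrArg WithLp.ofLp hx₀⟩

/-- The solution of `x(t+1) = A x(t) + h(t)` with `x(0) = x₀` (variation of parameters). -/
lemma exists_forward_solution (hc : c ≠ 0) (h : ℕ → Plane) (x₀ : Fin 2 → ℝ) :
    ∃ φ : ℕ → Plane, (φ 0).ofLp = x₀ ∧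
      (∀ t, φ (t + 1) = (companion b c).toEuclideanLin (φ t) + h t) ∧
      ∀ t, (φ t).ofLp = companion b c ^ t *ᵥ
        (x₀ + ∑ i ∈ Finset.range t, (companion b c ^ (i + 1))⁻¹ *ᵥ (h i).ofLp) := by
  let φ : ℕ → Plane := fun t => Nat.rec (WithLp.toLp 2 x₀)
    (fun t y => (companion b c).toEuclideanLin y + h t) t
  refine ⟨φ, rfl, fun t => rfl, fun t => ?_⟩
  induction t with
  | zero => simp [φ]
  | succ t ih =>
    have hs : (φ (t + 1)).ofLp = companion b c *ᵥ (φ t).ofLp + (h t).ofLp := rfl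
    have ht : IsUnit (companion b c ^ (t + 1)).det := by
      rw [Matrix.det_pow]; exact (isUnit_companion b hc).pow _
    rw [hs, ih, Finset.sum_range_succ, ← add_assoc, Matrix.mulVec_add _ _
      ((companion b c ^ (t + 1))⁻¹ *ᵥ (h t).ofLp), Matrix.mulVec_mulVec, Matrix.mulVec_mulVec,
      Matrix.mul_nonsing_inv _ ht, Matrix.one_mulVec, pow_succ']

lemma mem_range_linearOp [NeZero N] (hc : c ≠ 0) (w : Module.Basis (Fin k) ℝ (leftKer b c N))
    (h : PeriodicSpace N) (hm : moment w h = 0) : h ∈ LinearMap.range (linearOp b c N) := by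
  set s := ∑ i ∈ Finset.range N, (companion b c ^ (i + 1))⁻¹ *ᵥ (h i).ofLp with hs
  have hW : (basisMatrix w)ᵀ *ᵥ (companion b c ^ N *ᵥ s) = 0 := by
    rw [← hm, moment_apply, hs, Matrix.mulVec_mulVec, Matrix.mulVec_sum]
    refine Finset.sum_congr rfl fun i _ => ?_
    rw [Psi, Matrix.mulVec_mulVec, Matrix.transpose_mul, Matrix.transpose_mul,
      Matrix.transpose_transpose, Matrix.transpose_transpose, Matrix.mul_assoc]
  obtain ⟨x₀, hx₀⟩ := exists_of_basisMatrix_eq_zero w _ hW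
  obtain ⟨φ, h0, hrec, hφ⟩ := exists_forward_solution (b := b) hc (fun i => h i) x₀
  have hper : Function.Periodic φ N := by
    intro t
    induction t with
    | zero =>
      apply WithLp.ofLp_injective
      rw [zero_add, h0, hφ N, ← hs, Matrix.mulVec_add, ← hx₀, Matrix.sub_mulVec, Matrix.one_mulVec]
      abel
    | succ t ih =>
      rw [show t + 1 + N = t + N + 1 by ring, hrec, hrec, ih, h.periodic t]
  refine ⟨PeriodicSpace.mk φ hper, PeriodicSpace.ext fun t => ?_⟩
  rw [linearOp_apply, PeriodicSpace.mk_apply, PeriodicSpace.mk_apply, hrec, add_sub_cancel_left]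

lemma moment_projQ [NeZero N] (hc : c ≠ 0) (w : Module.Basis (Fin k) ℝ (leftKer b c N))
    (h : PeriodicSpace N) : moment w (projQ hc w h) = moment w h := by
  have h1 : moment w (projQ hc w h) = gram w *ᵥ ((gram w)⁻¹ *ᵥ moment w h) := by
    set u := (gram w)⁻¹ *ᵥ moment w h with hu
    rw [gram_eq hc, Matrix.sum_mulVec, moment_apply]
    refine Finset.sum_congr rfl fun i _ => ?_
    rw [projQ_apply, ← Matrix.mulVec_mulVec]
  rw [h1, Matrix.mulVec_mulVec, Matrix.mul_nonsing_inv _ (isUnit_gram w), Matrix.one_mulVec]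

lemma sub_projQ_mem_range [NeZero N] (hc : c ≠ 0)
    (w : Module.Basis (Fin k) ℝ (leftKer b c N)) (h : PeriodicSpace N) :
    ((LinearMap.id : PeriodicSpace N →ₗ[ℝ] PeriodicSpace N) - projQ hc w) h ∈ LinearMap.range (linearOp b c N) := by
  apply mem_range_linearOp hc w
  rw [LinearMap.sub_apply, LinearMap.id_apply, map_sub, moment_projQ, sub_self]

end Projections

section PartialInverse

lemma apply_of_mem_ker {b c : ℝ} {N : ℕ} [NeZero N] {x : PeriodicSpace N}
    (hx : linearOp b c N x = 0) (t : ℕ) :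
    x t = (companion b c ^ t).toEuclideanLin (x 0) := by
  induction t with
  | zero => simp
  | succ t ih =>
    have h := linearOp_apply b c N x t
    rw [hx] at h
    have h : x (t + 1) = (companion b c).toEuclideanLin (x t) := (sub_eq_zero.1 h.symm)
    rw [h, ih, pow_succ', Matrix.toLpLin_mul_same, LinearMap.comp_apply]

lemma projP_eq_self {b c : ℝ} {N : ℕ} [NeZero N] {x : PeriodicSpace N}
    (hx : linearOp b c N x = 0) : projP b c N x = x := by
  refine PeriodicSpace.ext fun t => ?_
  have h0 : x 0 ∈ rightKer b c N := by
    have h1 := apply_of_mem_ker hx N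
    have h2 := x.periodic 0
    rw [zero_add] at h2
    rw [mem_rightKer, ← h1, h2]
  rw [projP_apply, Submodule.starProjection_eq_self_iff.2 h0, apply_of_mem_ker hx t]

lemma linearOp_projP (b c : ℝ) (N : ℕ) [NeZero N] (x : PeriodicSpace N) :
    linearOp b c N (projP b c N x) = 0 :=
  PeriodicSpace.ext fun t => by
    rw [linearOp_apply, projP_apply, projP_apply, pow_succ', Matrix.toLpLin_mul_same,
      LinearMap.comp_apply, sub_self]
    rfl

lemma isCompl_ker (b c : ℝ) (N : ℕ) [NeZero N] :
    IsCompl (LinearMap.ker (projP b c N)) (LinearMap.ker (linearOp b c N)) := by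
  refine ⟨Submodule.disjoint_def.2 fun x hP hL => ?_, codisjoint_iff.2 (eq_top_iff.2 fun x _ => ?_)⟩
  · rw [← projP_eq_self hL]; exact hP
  · refine Submodule.mem_sup.2 ⟨x - projP b c N x, ?_, projP b c N x, linearOp_projP b c N x,
      sub_add_cancel _ _⟩
    rw [LinearMap.mem_ker, map_sub, projP_eq_self (linearOp_projP b c N x), sub_self]

/-- `M_p : Im 𝓛 → Ker P`, the inverse of the restriction of `𝓛` to `Ker P`
(a bijection of `Ker P` onto `Im 𝓛`, since `Ker P` is a complement of `Ker 𝓛`). -/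
def partialInv (b c : ℝ) (N : ℕ) [NeZero N] :
    LinearMap.range (linearOp b c N) ≃ₗ[ℝ] LinearMap.ker (projP b c N) :=
  ((linearOp b c N).kerComplementEquivRange (isCompl_ker b c N)).symm

variable {b c : ℝ} {N k : ℕ} [NeZero N]

/-- The operator `M_p (I - Q) : X_N → X_N`. -/
def solutionOp (hc : c ≠ 0) (w : Module.Basis (Fin k) ℝ (leftKer b c N)) :
    PeriodicSpace N →ₗ[ℝ] PeriodicSpace N :=
  (LinearMap.ker (projP b c N)).subtype ∘ₗ (partialInv b c N).toLinearMap ∘ₗ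
    ((LinearMap.id : PeriodicSpace N →ₗ[ℝ] PeriodicSpace N) - projQ hc w).codRestrict (LinearMap.range (linearOp b c N))
      (sub_projQ_mem_range hc w)

/-- The operator norm `‖M_p (I - Q)‖`, with respect to the supremum norm on `X_N`. -/
def solutionOpNorm (hc : c ≠ 0) (w : Module.Basis (Fin k) ℝ (leftKer b c N)) : ℝ :=
  ‖LinearMap.toContinuousLinearMap (solutionOp hc w)‖

end PartialInverse

end PeriodicDifference

end

/-!
The equation is a planar recurrence `x(t+1) = A x(t) + (0, g(t, x₀(t)))`, and its `N`-periodic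
solutions correspond to the fixed points of the period map `x(0) ↦ x(N)` of the plane. So a
two-dimensional topological tool is enough: the Poincaré–Miranda theorem (`poincare_miranda`),
which follows from the existence of a continuous logarithm of a nowhere vanishing map on the plane.

Freeze `g` outside `[-2r, 2r]`. It is then bounded by `δ`, so the period map differs from `A^N` by a
bounded map, and it keeps the sign condition (C2), as `z < 2r`.

* If `1 + b + c ≠ 0`, then (C4) and the oddness of `N` exclude every `N`-th root of unity as a
  characteristic root (`pow_ne_one_of_root`). Hence `I - A^N` is invertible, and Poincaré–Miranda
  applies on a large square (`exists_periodic_of_isUnit`).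
* If `1 + b + c = 0`, the constants solve the linear equation. In the coordinates
  `ρ = y(1) - y(0)`, `s = y(0)` the displacement `y(N) - y(0)` is
  `ρ (1 + c + ⋯ + c^(N-1))` up to a bounded term, with a positive factor as `N` is odd, while the
  increment of `y(t+1) - c y(t)` over a period is `∑ g(t, y(t))`, whose sign is governed by (C2).
  Poincaré–Miranda applies on a suitable rectangle (`exists_periodic_of_resonance`).

The solution `y` found in this way stays in `[-2r, 2r]`, where the truncation has no effect: since
`Q 𝓛 = 0`, the operator `M_p (I - Q)` maps `𝓛 x` to `x - P x`, so `y` differs by at most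
`‖M_p (I - Q)‖ δ < r - z` from a constant `α` (`exists_abs_sub_le`). Here `α = 0` without resonance,
and in resonance `|α| < r`, since otherwise all `g(t, y(t))` would have the same sign, although they
sum to zero over a period.
-/

namespace PeriodicDifference

/-! ### The Poincaré–Miranda theorem in the plane -/

lemma exists_continuous_log {f : ℝ × ℝ → ℂ} (hf : Continuous f) (h0 : ∀ p, f p ≠ 0) :
    ∃ L : ℝ × ℝ → ℂ, Continuous L ∧ ∀ p, Complex.exp (L p) = f p := by
  obtain ⟨F, ⟨-, hF⟩, -⟩ := Complex.isCoveringMapOn_exp.existsUnique_continuousMap_lifts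
    (⟨f, hf⟩ : C(ℝ × ℝ, ℂ)) (a₀ := 0) (e₀ := Complex.log (f 0)) (Complex.exp_log (h0 0))
    (fun p => h0 p)
  exact ⟨F, F.continuous, fun p => congrFun hF p⟩

lemma eq_of_exp_eq_one {h : ℝ → ℂ} (hc : Continuous h) (h1 : ∀ θ, Complex.exp (h θ) = 1)
    (θ θ' : ℝ) : h θ = h θ' := by
  have := Complex.isCoveringMap_exp.eq_of_comp_eq (g₁ := h) (g₂ := fun _ => h θ') hc
    continuous_const (by funext s; exact Subtype.ext ((h1 s).trans (h1 θ').symm)) θ' rfl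
  exact congrFun this θ

/-- A nowhere vanishing continuous map of the plane has winding number `0` along every circle, so
it cannot avoid the direction opposite to the radius vector along a whole circle: otherwise its
winding number there would be that of the circle itself. -/
lemma exists_not_mem_slitPlane {f : ℝ × ℝ → ℂ} (hf : Continuous f) (h0 : ∀ p, f p ≠ 0) (M : ℝ) :
    ∃ θ : ℝ, f (M * Real.cos θ, M * Real.sin θ) * Complex.exp (-(θ * Complex.I)) ∉
      Complex.slitPlane := by
  by_contra! hs
  obtain ⟨L, hL, hexp⟩ := exists_continuous_log hf h0
  set w : ℝ → ℂ := fun θ =>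
    f (M * Real.cos θ, M * Real.sin θ) * Complex.exp (-(θ * Complex.I)) with hw
  have hwc : Continuous w := by fun_prop
  have hcont : Continuous fun θ : ℝ =>
      L (M * Real.cos θ, M * Real.sin θ) - Complex.log (w θ) - θ * Complex.I := by
    have := hwc.clog hs
    fun_prop
  have h := eq_of_exp_eq_one hcont (fun θ => by
    have hne : Complex.exp (θ * Complex.I) ≠ 0 := Complex.exp_ne_zero _
    have hf0 := h0 (M * Real.cos θ, M * Real.sin θ)
    rw [Complex.exp_sub, Complex.exp_sub, hexp, Complex.exp_log (Complex.slitPlane_ne_zero (hs θ)),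
      Complex.exp_neg]
    field_simp) (2 * Real.pi) 0
  have hw0 : w (2 * Real.pi) = w 0 := by
    simp only [hw, Real.cos_two_pi, Real.sin_two_pi, Real.cos_zero, Real.sin_zero]
    congr 1
    push_cast
    rw [Complex.exp_neg, Complex.exp_two_pi_mul_I]
    simp
  rw [hw0] at h
  simp [Real.pi_ne_zero] at h

/-- The **Poincaré–Miranda theorem** in the plane: two continuous functions on a rectangle, the
first of which changes sign between the vertical sides and the second between the horizontal ones,
have a common zero. -/
theorem poincare_miranda {R S : ℝ} (hR : 0 < R) (hS : 0 < S) {f₁ f₂ : ℝ × ℝ → ℝ}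
    (hf₁ : Continuous f₁) (hf₂ : Continuous f₂)
    (hl : ∀ y ∈ Set.Icc (-S) S, f₁ (-R, y) < 0) (hr : ∀ y ∈ Set.Icc (-S) S, 0 < f₁ (R, y))
    (hb : ∀ x ∈ Set.Icc (-R) R, f₂ (x, -S) < 0) (ht : ∀ x ∈ Set.Icc (-R) R, 0 < f₂ (x, S)) :
    ∃ p : ℝ × ℝ, p.1 ∈ Set.Icc (-R) R ∧ p.2 ∈ Set.Icc (-S) S ∧ f₁ p = 0 ∧ f₂ p = 0 := by
  by_contra! hne
  set q₁ : ℝ → ℝ := fun x => Set.projIcc (-R) R (by linarith) x with hq₁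
  set q₂ : ℝ → ℝ := fun y => Set.projIcc (-S) S (by linarith) y with hq₂
  have hq₁c : Continuous q₁ := by fun_prop
  have hq₂c : Continuous q₂ := by fun_prop
  have hm₁ : ∀ x, q₁ x ∈ Set.Icc (-R) R := fun x => Subtype.property _
  have hm₂ : ∀ y, q₂ y ∈ Set.Icc (-S) S := fun y => Subtype.property _
  obtain ⟨θ, hθ⟩ := exists_not_mem_slitPlane
    (f := fun p => (f₁ (q₁ p.1, q₂ p.2) : ℂ) + f₂ (q₁ p.1, q₂ p.2) * Complex.I)
    (by fun_prop) (fun p h => hne (q₁ p.1, q₂ p.2) (hm₁ _) (hm₂ _)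
      (by simpa using congrArg Complex.re h) (by simpa using congrArg Complex.im h)) (R + S)
  set x := (R + S) * Real.cos θ with hx
  set y := (R + S) * Real.sin θ with hy
  set u := f₁ (q₁ x, q₂ y) with hu
  set v := f₂ (q₁ x, q₂ y) with hv
  rw [← neg_mul, ← Complex.ofReal_neg, Complex.mem_slitPlane_iff, Complex.exp_mul_I] at hθ
  simp only [← Complex.ofReal_cos, ← Complex.ofReal_sin, Real.cos_neg, Real.sin_neg] at hθ
  simp [-Complex.ofReal_cos, -Complex.ofReal_sin] at hθ
  obtain ⟨hre, him⟩ := hθ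
  have hcs := Real.sin_sq_add_cos_sq θ
  -- `(u, v)` is a nonpositive multiple of `(cos θ, sin θ)`
  set l := u * Real.cos θ + v * Real.sin θ with hl'
  have hul : u = l * Real.cos θ := by linear_combination -u * hcs - him * Real.sin θ
  have hvl : v = l * Real.sin θ := by linear_combination -v * hcs + him * Real.cos θ
  have hl0 : l ≤ 0 := hre
  have hpos : 0 < R + S := by linarith
  -- the point on the circle of radius `R + S` lies outside the rectangle
  have hout : R ≤ |x| ∨ S ≤ |y| := by
    by_contra! h
    have h1 : x ^ 2 + y ^ 2 = (R + S) ^ 2 := by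
      rw [hx, hy]; linear_combination (R + S) ^ 2 * hcs
    have h2 := abs_nonneg x
    have h3 := abs_nonneg y
    nlinarith [sq_abs x, sq_abs y]
  rcases hout with h | h
  · rcases le_abs'.1 h with h | h
    · have h1 : q₁ x = -R := by simp only [hq₁, Set.projIcc_of_le_left _ h]
      have h2 : u < 0 := by rw [hu, h1]; exact hl _ (hm₂ _)
      have h3 : Real.cos θ < 0 := by by_contra! h4; nlinarith [mul_nonneg hpos.le h4]
      nlinarith
    · have h1 : q₁ x = R := by simp only [hq₁, Set.projIcc_of_right_le _ h]
      have h2 : 0 < u := by rw [hu, h1]; exact hr _ (hm₂ _)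
      have h3 : 0 < Real.cos θ := by by_contra! h4; nlinarith [mul_nonneg hpos.le (neg_nonneg.2 h4)]
      nlinarith
  · rcases le_abs'.1 h with h | h
    · have h1 : q₂ y = -S := by simp only [hq₂, Set.projIcc_of_le_left _ h]
      have h2 : v < 0 := by rw [hv, h1]; exact hb _ (hm₁ _)
      have h3 : Real.sin θ < 0 := by by_contra! h4; nlinarith [mul_nonneg hpos.le h4]
      nlinarith
    · have h1 : q₂ y = S := by simp only [hq₂, Set.projIcc_of_right_le _ h]
      have h2 : 0 < v := by rw [hv, h1]; exact ht _ (hm₁ _)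
      have h3 : 0 < Real.sin θ := by by_contra! h4; nlinarith [mul_nonneg hpos.le (neg_nonneg.2 h4)]
      nlinarith

/-! ### Bounded perturbations of a linear recurrence -/

section Orbit

variable {E : Type*} [NormedAddCommGroup E] [NormedSpace ℝ E]

/-- The solution of `x(t+1) = A x(t) + F(t, x(t))` with initial value `x`. -/
def orbit (A : E →L[ℝ] E) (F : ℕ → E → E) (x : E) : ℕ → E
  | 0 => x
  | t + 1 => A (orbit A F x t) + F t (orbit A F x t)

variable {A : E →L[ℝ] E} {F : ℕ → E → E}

lemma continuous_orbit (hF : ∀ t, Continuous (F t)) (t : ℕ) :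
    Continuous fun x => orbit A F x t := by
  induction t with
  | zero => exact continuous_id
  | succ t ih => exact (A.continuous.comp ih).add ((hF t).comp ih)

lemma exists_norm_orbit_sub_le {δ : ℝ} (hF : ∀ t x, ‖F t x‖ ≤ δ) (t : ℕ) :
    ∃ C, ∀ x, ‖orbit A F x t - (A ^ t) x‖ ≤ C := by
  induction t with
  | zero => exact ⟨0, fun x => by simp [orbit]⟩
  | succ t ih =>
    obtain ⟨C, hC⟩ := ih
    refine ⟨‖A‖ * C + δ, fun x => ?_⟩
    have h : orbit A F x (t + 1) - (A ^ (t + 1)) x =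
        A (orbit A F x t - (A ^ t) x) + F t (orbit A F x t) := by
      rw [orbit, pow_succ', mul_apply_eq_comp, map_sub]
      abel
    rw [h]
    exact (norm_add_le _ _).trans (add_le_add
      ((A.le_opNorm _).trans (mul_le_mul_of_nonneg_left (hC x) (norm_nonneg _))) (hF _ _))

lemma orbit_periodic {N : ℕ} (hF : ∀ t x, F (t + N) x = F t x) {x : E}
    (hx : orbit A F x N = x) : Function.Periodic (orbit A F x) N := by
  intro t
  induction t with
  | zero => rw [zero_add, hx, orbit]
  | succ t ih => rw [show t + 1 + N = t + N + 1 by ring, orbit, orbit, ih, hF]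

end Orbit

/-! ### The scalar equation as a planar recurrence -/

/-- The companion matrix as an operator on the Euclidean plane. -/
noncomputable def companionCLM (b c : ℝ) : Plane →L[ℝ] Plane :=
  Matrix.toEuclideanCLM (n := Fin 2) (𝕜 := ℝ) (companion b c)

lemma companionCLM_apply (b c : ℝ) (x : Plane) :
    companionCLM b c x = !₂[x 1, -c * x 0 - b * x 1] := by
  ext i
  fin_cases i <;>
    simp [companionCLM, companion, Matrix.mulVec, dotProduct, Fin.sum_univ_two]
  ring

lemma companionCLM_pow_apply (b c : ℝ) (t : ℕ) (x : Plane) :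
    (companionCLM b c ^ t) x = (companion b c ^ t).toEuclideanLin x := by
  rw [companionCLM, ← map_pow]
  rfl

lemma mem_rightKer_iff {b c : ℝ} {N : ℕ} {v : Plane} :
    v ∈ rightKer b c N ↔ (companionCLM b c ^ N) v = v := by
  rw [mem_rightKer, companionCLM_pow_apply]

/-- The nonlinearity `h(t, y)`, placed in the second component. -/
def forcing (h : ℕ → ℝ → ℝ) (t : ℕ) (x : Plane) : Plane := !₂[0, h t (x 0)]

lemma continuous_forcing {h : ℕ → ℝ → ℝ} (hh : ∀ t, Continuous (h t)) (t : ℕ) :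
    Continuous (forcing h t) := by
  have := hh t
  unfold forcing
  fun_prop

lemma norm_forcing (h : ℕ → ℝ → ℝ) (t : ℕ) (x : Plane) : ‖forcing h t x‖ = |h t (x 0)| := by
  simp [forcing, EuclideanSpace.norm_eq, Fin.sum_univ_two, Real.sqrt_sq_eq_abs]

lemma abs_apply_le_norm (x : Plane) (i : Fin 2) : |x i| ≤ ‖x‖ := PiLp.norm_apply_le x i

section Existence

variable {b c : ℝ} {h : ℕ → ℝ → ℝ}

lemma orbit_succ_zero (x : Plane) (t : ℕ) :
    orbit (companionCLM b c) (forcing h) x (t + 1) 0 =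
      orbit (companionCLM b c) (forcing h) x t 1 := by
  simp [orbit, companionCLM_apply, forcing]

lemma orbit_succ_one (x : Plane) (t : ℕ) :
    orbit (companionCLM b c) (forcing h) x (t + 1) 1 =
      -c * orbit (companionCLM b c) (forcing h) x t 0 -
        b * orbit (companionCLM b c) (forcing h) x t 1 +
        h t (orbit (companionCLM b c) (forcing h) x t 0) := by
  simp [orbit, companionCLM_apply, forcing]

/-- A fixed point of the period map is the initial value of a periodic solution. -/
lemma exists_periodic_of_orbit_eq {N : ℕ} (hper : ∀ t x, h (t + N) x = h t x) {x : Plane}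
    (hx : orbit (companionCLM b c) (forcing h) x N = x) :
    ∃ y : ℕ → ℝ, (∀ t, y (t + N) = y t) ∧
      ∀ t, y (t + 2) + b * y (t + 1) + c * y t = h t (y t) := by
  have hp := orbit_periodic (A := companionCLM b c) (F := forcing h)
    (fun t x => by simp only [forcing, hper]) hx
  refine ⟨fun t => orbit (companionCLM b c) (forcing h) x t 0, fun t => by simp only [hp t],
    fun t => ?_⟩
  simp only [orbit_succ_zero, orbit_succ_one]
  ring

/-- Away from resonance the period map differs from a linear map without the eigenvalue `1` by a
bounded term, so it has a fixed point. -/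
lemma exists_periodic_of_isUnit {N : ℕ} {δ : ℝ} (hh : ∀ t, Continuous (h t))
    (hper : ∀ t x, h (t + N) x = h t x) (hδ : ∀ t x, |h t x| ≤ δ)
    (hu : IsUnit (1 - companionCLM b c ^ N)) :
    ∃ y : ℕ → ℝ, (∀ t, y (t + N) = y t) ∧
      ∀ t, y (t + 2) + b * y (t + 1) + c * y t = h t (y t) := by
  set A := companionCLM b c with hA
  set T := fun x => orbit A (forcing h) x N with hT
  have hTc : Continuous T := continuous_orbit (continuous_forcing hh) N
  obtain ⟨C, hC⟩ := exists_norm_orbit_sub_le (A := A) (F := forcing h)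
    (fun t x => (norm_forcing h t x).trans_le (hδ t _)) N
  obtain ⟨U, hU⟩ := hu
  -- `x - G x` is the displacement `x - T x`, rescaled by `(1 - A^N)⁻¹`
  set G : Plane → Plane := fun x => (U⁻¹).val (T x - (A ^ N) x) with hG
  have hGc : Continuous G := by fun_prop
  have hGb : ∀ x i, |G x i| ≤ ‖(U⁻¹).val‖ * C := fun x i =>
    (abs_apply_le_norm _ i).trans
      (((U⁻¹).val.le_opNorm _).trans (mul_le_mul_of_nonneg_left (hC x) (norm_nonneg _)))
  set R := ‖(U⁻¹).val‖ * C + 1 with hR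
  have hR0 : 0 < R := by
    have := (abs_nonneg _).trans (hGb 0 0)
    linarith
  obtain ⟨p, -, -, h1, h2⟩ := poincare_miranda hR0 hR0
    (f₁ := fun p => p.1 - G !₂[p.1, p.2] 0) (f₂ := fun p => p.2 - G !₂[p.1, p.2] 1)
    (by fun_prop) (by fun_prop)
    (fun y _ => by have := abs_le.1 (hGb !₂[-R, y] 0); simp only; linarith)
    (fun y _ => by have := abs_le.1 (hGb !₂[R, y] 0); simp only; linarith)
    (fun y _ => by have := abs_le.1 (hGb !₂[y, -R] 1); simp only; linarith)
    (fun y _ => by have := abs_le.1 (hGb !₂[y, R] 1); simp only; linarith)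
  refine exists_periodic_of_orbit_eq hper (x := !₂[p.1, p.2]) ?_
  set x : Plane := !₂[p.1, p.2] with hx
  have hxG : G x = x := by
    ext i
    fin_cases i
    · change G x 0 = p.1; linarith
    · change G x 1 = p.2; linarith
  have h3 : (1 - A ^ N) (G x) = T x - (A ^ N) x := by
    rw [← hU, hG, ← mul_apply_eq_comp, U.mul_inv, one_apply_eq_self]
  rw [hxG] at h3
  change T x = x
  simpa [sub_left_inj] using h3.symm

end Existence

/-! ### Characteristic roots and invertibility of `I - A^N` -/

/-- If no root of `X² + b X + c` is an `N`-th root of unity, then `X² + b X + c` and `X^N - 1` are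
coprime, so `a^N - 1` is invertible for every root `a` of the former in any algebra. -/
lemma isUnit_one_sub_pow {B : Type*} [Ring B] [Algebra ℝ B] {a : B} {b c : ℝ} {N : ℕ}
    (ha : a ^ 2 + b • a + c • (1 : B) = 0)
    (hroot : ∀ l : ℂ, l ^ 2 + b * l + c = 0 → l ^ N ≠ 1) : IsUnit (1 - a ^ N) := by
  open Polynomial in
  have hco : IsCoprime (X ^ 2 + C b * X + C c : ℝ[X]) (X ^ N - 1) := by
    rw [Polynomial.isCoprime_iff_aeval_ne_zero_of_isAlgClosed ℝ ℂ]
    intro l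
    by_cases h : l ^ 2 + b * l + c = 0
    · right
      simpa [sub_eq_zero] using hroot l h
    · left
      simpa using h
  obtain ⟨p, q, hpq⟩ := hco
  have h0 : Polynomial.aeval a (Polynomial.X ^ 2 + Polynomial.C b * Polynomial.X + Polynomial.C c)
      = 0 := by
    rw [← ha]
    simp [Algebra.smul_def]
  have h1 := congrArg (Polynomial.aeval a) hpq
  rw [map_add, map_mul, map_mul, h0, mul_zero, zero_add, map_one] at h1
  have h2 := h1
  rw [← map_mul, mul_comm q, map_mul] at h2
  have h3 : Polynomial.aeval a (Polynomial.X ^ N - 1 : Polynomial ℝ) = a ^ N - 1 := by simp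
  rw [h3] at h1 h2
  rw [← neg_sub, IsUnit.neg_iff]
  exact ⟨⟨_, _, h2, h1⟩, rfl⟩

/-- Under (C4) the only `N`-th root of unity that can be a characteristic root is `1`. -/
lemma pow_ne_one_of_root {N : ℕ} (hN : N ≠ 0) (hodd : Odd N) {b c : ℝ} (hbc : 1 + b + c ≠ 0)
    (C4 : (∃ m : ℤ, (N : ℝ) * Real.arccos (-b / 2) = m * (2 * Real.pi)) → c ≠ 1 ∨ 2 ≤ |b|)
    {l : ℂ} (hl : l ^ 2 + b * l + c = 0) : l ^ N ≠ 1 := by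
  intro h1
  have hnorm : ‖l‖ = 1 := by
    have := congrArg norm h1
    rw [norm_pow, norm_one] at this
    exact (pow_eq_one_iff_of_nonneg (norm_nonneg _) hN).1 this
  by_cases him : l.im = 0
  · obtain ⟨s, rfl⟩ : ∃ s : ℝ, (s : ℂ) = l := ⟨l.re, Complex.ext rfl (by simp [him])⟩
    have hs : s = 1 := by
      have : s ^ N = 1 := by exact_mod_cast h1
      exact hodd.strictMono_pow.injective (by simpa using this)
    subst hs
    apply hbc
    have : (1 : ℝ) ^ 2 + b * 1 + c = 0 := by exact_mod_cast hl
    linarith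
  · have hre := congrArg Complex.re hl
    have him' := congrArg Complex.im hl
    simp [pow_two] at hre him'
    have hb : b = -2 * l.re := by
      apply mul_left_cancel₀ him
      linear_combination him'
    have hsq : l.re ^ 2 + l.im ^ 2 = 1 := by
      have := Complex.sq_norm l
      rw [hnorm, Complex.normSq_apply] at this
      linarith
    have hc1 : c = 1 := by rw [hb] at hre; linear_combination hre + hsq
    have him2 : 0 < l.im ^ 2 := by positivity
    have hb2 : |b| < 2 := by
      rw [abs_lt]; constructor <;> nlinarith
    have harg : Real.arccos (-b / 2) = |Complex.arg l| := by
      have : -b / 2 = Real.cos (Complex.arg l) := by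
        rw [Complex.cos_arg (by intro h; simp [h] at hnorm), hnorm, hb]; ring
      rw [this, ← Real.cos_abs,
        Real.arccos_cos (abs_nonneg _) (Complex.abs_arg_le_pi l)]
    have hexp : Complex.exp ((N : ℂ) * (Complex.arg l * Complex.I)) = 1 := by
      have h2 := Complex.norm_mul_exp_arg_mul_I l
      rw [hnorm, Complex.ofReal_one, one_mul] at h2
      rw [Complex.exp_nat_mul, h2, h1]
    obtain ⟨m, hm⟩ := Complex.exp_eq_one_iff.1 hexp
    have hm' : (N : ℝ) * Complex.arg l = m * (2 * Real.pi) := by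
      have := congrArg Complex.im hm
      simpa using this
    have : c ≠ 1 ∨ 2 ≤ |b| := by
      apply C4
      rw [harg]
      rcases abs_choice (Complex.arg l) with h | h
      · exact ⟨m, by rw [h, hm']⟩
      · exact ⟨-m, by rw [h]; push_cast; linarith⟩
    rcases this with h | h
    · exact h hc1
    · linarith

lemma isUnit_one_sub_companionCLM_pow {N : ℕ} (hN : N ≠ 0) (hodd : Odd N) {b c : ℝ}
    (hbc : 1 + b + c ≠ 0)
    (C4 : (∃ m : ℤ, (N : ℝ) * Real.arccos (-b / 2) = m * (2 * Real.pi)) → c ≠ 1 ∨ 2 ≤ |b|) :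
    IsUnit (1 - companionCLM b c ^ N) := by
  refine isUnit_one_sub_pow (b := b) (c := c) ?_
    fun l hl => pow_ne_one_of_root hN hodd hbc C4 hl
  ext x i
  fin_cases i <;> simp [pow_two, companionCLM_apply]

/-! ### The resonant case -/

lemma companionCLM_pow_apply_of_resonance {b c : ℝ} (hbc : 1 + b + c = 0) (t : ℕ) (s ρ : ℝ) :
    (companionCLM b c ^ t) !₂[s, s + ρ] =
      !₂[s + ρ * ∑ i ∈ Finset.range t, c ^ i, s + ρ * ∑ i ∈ Finset.range (t + 1), c ^ i] := by
  induction t with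
  | zero => simp
  | succ t ih =>
    rw [pow_succ', mul_apply_eq_comp, ih, companionCLM_apply]
    ext i
    fin_cases i
    · simp
    · simp only [Finset.sum_range_succ, pow_succ, Fin.mk_one,
        Matrix.cons_val_one, Matrix.cons_val_zero, Fin.isValue, Matrix.cons_val_fin_one]
      linear_combination (-(s + ρ * (∑ i ∈ Finset.range t, c ^ i + c ^ t))) * hbc

lemma eq_zero_of_mem_rightKer {b c : ℝ} {N : ℕ} (hu : IsUnit (1 - companionCLM b c ^ N))
    {v : Plane} (hv : v ∈ rightKer b c N) : v = 0 := by
  rw [mem_rightKer_iff] at hv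
  obtain ⟨U, hU⟩ := hu
  have h1 : U.val v = 0 := by rw [hU]; simp [hv]
  have h2 : (U⁻¹.val * U.val) v = v := by rw [U.inv_mul, one_apply_eq_self]
  rw [← h2, mul_apply_eq_comp, h1, map_zero]

/-- In resonance, the kernel of `I - A^N` consists of constant vectors: the first component of
`A^N v - v` is `(v₁ - v₀) (1 + c + ⋯ + c^(N-1))`, and the second factor is positive for odd `N`. -/
lemma apply_eq_of_mem_rightKer {N : ℕ} (hodd : Odd N) {b c : ℝ} (hbc : 1 + b + c = 0) {v : Plane}
    (hv : v ∈ rightKer b c N) : v 1 = v 0 := by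
  rw [mem_rightKer_iff] at hv
  have hv' : v = !₂[v 0, v 0 + (v 1 - v 0)] := by
    ext i; fin_cases i <;> simp
  rw [hv', companionCLM_pow_apply_of_resonance hbc] at hv
  have h0 := congrArg (fun x : Plane => x 0) hv
  simp only [Matrix.cons_val_zero, add_eq_left, mul_eq_zero] at h0
  rcases h0 with h0 | h0
  · linarith
  · exact absurd h0 hodd.geom_sum_pos.ne'

/-- In resonance the first integral `y(t+1) - c y(t)` of the linear equation changes by `h(t, y(t))`
in each step. -/
lemma orbit_one_sub_of_resonance {b c : ℝ} (hbc : 1 + b + c = 0) {h : ℕ → ℝ → ℝ} (x : Plane)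
    (t : ℕ) : orbit (companionCLM b c) (forcing h) x t 1 -
        c * orbit (companionCLM b c) (forcing h) x t 0 =
      x 1 - c * x 0 +
        ∑ i ∈ Finset.range t, h i (orbit (companionCLM b c) (forcing h) x i 0) := by
  induction t with
  | zero => simp [orbit]
  | succ t ih =>
    rw [Finset.sum_range_succ, ← add_assoc, ← ih, orbit_succ_zero, orbit_succ_one]
    linear_combination (-orbit (companionCLM b c) (forcing h) x t 1) * hbc

/-- In resonance, in the coordinates `ρ = y(1) - y(0)` and `s = y(0)`, the displacement
`y(N) - y(0)` has the sign of `ρ` for large `|ρ|`, and the increment `∑ h(t, y(t))` of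
`y(t+1) - c y(t)` over a period has the sign of `s` for `|s|` large compared with `|ρ|`. -/
lemma exists_periodic_of_resonance {N : ℕ} (hN : 0 < N) (hodd : Odd N) {b c z δ : ℝ}
    (hbc : 1 + b + c = 0) {h : ℕ → ℝ → ℝ} (hh : ∀ t, Continuous (h t))
    (hper : ∀ t x, h (t + N) x = h t x) (hδ : ∀ t x, |h t x| ≤ δ)
    (hneg : ∀ t x, x < -z → h t x < 0) (hpos : ∀ t x, z < x → 0 < h t x) :
    ∃ y : ℕ → ℝ, (∀ t, y (t + N) = y t) ∧
      ∀ t, y (t + 2) + b * y (t + 1) + c * y t = h t (y t) := by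
  set A := companionCLM b c with hA
  set Y : ℕ → ℝ × ℝ → Plane := fun t p => orbit A (forcing h) !₂[p.2, p.2 + p.1] t with hY
  have hYc : ∀ t, Continuous (Y t) := fun t =>
    (continuous_orbit (continuous_forcing hh) t).comp (by fun_prop)
  choose C hC using fun t => exists_norm_orbit_sub_le (A := A) (F := forcing h)
    (fun t x => (norm_forcing h t x).trans_le (hδ t _)) t
  set Γ : ℕ → ℝ := fun t => ∑ i ∈ Finset.range t, c ^ i with hΓ
  have hYb : ∀ t p, |Y t p 0 - (p.2 + p.1 * Γ t)| ≤ C t := by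
    intro t p
    have h1 := (abs_apply_le_norm _ 0).trans (hC t !₂[p.2, p.2 + p.1])
    rw [companionCLM_pow_apply_of_resonance hbc] at h1
    simpa using h1
  have hC0 : ∀ t, 0 ≤ C t := fun t => (abs_nonneg _).trans (hYb t 0)
  have hΓN : 0 < Γ N := hodd.geom_sum_pos
  set R := (C N + 1) / Γ N with hR
  have hR0 : 0 < R := div_pos (by linarith [hC0 N]) hΓN
  have hRΓ : R * Γ N = C N + 1 := div_mul_cancel₀ _ hΓN.ne'
  set D := ∑ t ∈ Finset.range N, (R * |Γ t| + C t) with hD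
  have hterm : ∀ t, 0 ≤ R * |Γ t| + C t := fun t =>
    add_nonneg (mul_nonneg hR0.le (abs_nonneg _)) (hC0 t)
  have hD0 : 0 ≤ D := Finset.sum_nonneg fun t _ => hterm t
  have hYs : ∀ t ∈ Finset.range N, ∀ p : ℝ × ℝ, p.1 ∈ Set.Icc (-R) R →
      |Y t p 0 - p.2| ≤ D := by
    intro t ht p hp
    have h1 : R * |Γ t| + C t ≤ D :=
      Finset.single_le_sum (f := fun t => R * |Γ t| + C t) (fun t _ => hterm t) ht
    have h2 : |p.1 * Γ t| ≤ R * |Γ t| := by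
      rw [abs_mul]
      exact mul_le_mul_of_nonneg_right (abs_le.2 hp) (abs_nonneg _)
    calc |Y t p 0 - p.2| = |(Y t p 0 - (p.2 + p.1 * Γ t)) + p.1 * Γ t| := by ring_nf
      _ ≤ _ := (abs_add_le _ _).trans (by linarith [hYb t p])
  have hne : (Finset.range N).Nonempty := Finset.nonempty_range_iff.2 hN.ne'
  obtain ⟨p, -, -, h1, h2⟩ := poincare_miranda (R := R) (S := |z| + D + 1) hR0
    (by positivity) (f₁ := fun p => Y N p 0 - p.2)
    (f₂ := fun p => ∑ t ∈ Finset.range N, h t (Y t p 0))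
    (by fun_prop) (by fun_prop)
    (fun y _ => by have := abs_le.1 (hYb N (-R, y)); simp only at this ⊢; linarith)
    (fun y _ => by have := abs_le.1 (hYb N (R, y)); simp only at this ⊢; linarith)
    (fun x hx => Finset.sum_neg (fun t ht => hneg t _ (by
      have := abs_le.1 (hYs t ht (x, -(|z| + D + 1)) hx)
      simp only at this
      linarith [le_abs_self z])) hne)
    (fun x hx => Finset.sum_pos (fun t ht => hpos t _ (by
      have := abs_le.1 (hYs t ht (x, |z| + D + 1) hx)
      simp only at this
      linarith [le_abs_self z])) hne)
  refine exists_periodic_of_orbit_eq hper (x := !₂[p.2, p.2 + p.1]) ?_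
  have h3 := orbit_one_sub_of_resonance hbc (h := h) !₂[p.2, p.2 + p.1] N
  change Y N p 1 - c * Y N p 0 = _ + ∑ t ∈ Finset.range N, h t (Y t p 0) at h3
  rw [h2] at h3
  simp only [Matrix.cons_val_one, Matrix.cons_val_zero] at h3
  change Y N p = _
  ext i
  fin_cases i
  · change Y N p 0 = p.2; linarith
  · change Y N p 1 = p.2 + p.1
    linear_combination h3 + c * h1

/-! ### The estimate through `M_p (I - Q)` -/

lemma Psi_succ_transpose_mul {b c : ℝ} (hc : c ≠ 0) {N k : ℕ}
    (w : Module.Basis (Fin k) ℝ (leftKer b c N)) (t : ℕ) :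
    (Psi w (t + 1))ᵀ * companion b c = (Psi w t)ᵀ := by
  have h1 : (companion b c ^ (t + 1))⁻¹ * companion b c = (companion b c ^ t)⁻¹ := by
    rw [pow_succ', Matrix.mul_inv_rev, Matrix.mul_assoc,
      Matrix.nonsing_inv_mul _ (isUnit_companion b hc), Matrix.mul_one]
  simp only [Psi, Matrix.transpose_mul, Matrix.transpose_transpose]
  rw [Matrix.mul_assoc, Matrix.mul_assoc, h1]

/-- The sum of `Ψ(i+1)ᵀ (𝓛 x)(i) = Ψ(i+1)ᵀ x(i+1) - Ψ(i)ᵀ x(i)` over a period telescopes. -/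
lemma moment_linearOp {b c : ℝ} (hc : c ≠ 0) {N k : ℕ} [NeZero N]
    (w : Module.Basis (Fin k) ℝ (leftKer b c N)) (x : PeriodicSpace N) :
    moment w (linearOp b c N x) = 0 := by
  have h : ∀ i, (Psi w (i + 1))ᵀ *ᵥ (linearOp b c N x i).ofLp =
      (Psi w (i + 1))ᵀ *ᵥ (x (i + 1)).ofLp - (Psi w i)ᵀ *ᵥ (x i).ofLp := by
    intro i
    rw [← Psi_succ_transpose_mul hc w i, ← Matrix.mulVec_mulVec, ← Matrix.mulVec_sub]
    rfl
  rw [moment_apply]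
  simp only [h]
  rw [Finset.sum_range_sub (fun i => (Psi w i)ᵀ *ᵥ (x i).ofLp)]
  have h1 := Psi_periodic hc w 0
  have h2 := x.periodic 0
  rw [zero_add] at h1 h2
  rw [h1, h2, sub_self]

/-- On the image of `𝓛` the projection `Q` vanishes, so there `M_p (I - Q)` inverts `𝓛` up to the
kernel component. -/
lemma solutionOp_linearOp {b c : ℝ} (hc : c ≠ 0) {N k : ℕ} [NeZero N]
    (w : Module.Basis (Fin k) ℝ (leftKer b c N)) (x : PeriodicSpace N) :
    solutionOp hc w (linearOp b c N x) = x - projP b c N x := by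
  have hQ : projQ hc w (linearOp b c N x) = 0 := PeriodicSpace.ext fun t => by
    rw [projQ_apply, moment_linearOp hc, Matrix.mulVec_zero, Matrix.mulVec_zero]
    rfl
  have hP : x - projP b c N x ∈ LinearMap.ker (projP b c N) := by
    rw [LinearMap.mem_ker, map_sub, projP_eq_self (linearOp_projP b c N x), sub_self]
  have h1 : ((LinearMap.id : PeriodicSpace N →ₗ[ℝ] PeriodicSpace N) - projQ hc w).codRestrict
      (LinearMap.range (linearOp b c N)) (sub_projQ_mem_range hc w) (linearOp b c N x) =
      (linearOp b c N).kerComplementEquivRange (isCompl_ker b c N) ⟨x - projP b c N x, hP⟩ := by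
    apply Subtype.ext
    change linearOp b c N x - projQ hc w (linearOp b c N x) = linearOp b c N (x - projP b c N x)
    rw [hQ, map_sub, linearOp_projP]
  simp only [solutionOp, LinearMap.comp_apply]
  rw [h1]
  simp [partialInv]

lemma PeriodicSpace.norm_apply_le {N : ℕ} (x : PeriodicSpace N) (t : ℕ) : ‖x t‖ ≤ ‖x‖ :=
  let φ : periodicSubmodule N := x
  φ.1.norm_coe_le_norm t

lemma PeriodicSpace.norm_le {N : ℕ} {x : PeriodicSpace N} {C : ℝ} (hC : 0 ≤ C)
    (h : ∀ t, ‖x t‖ ≤ C) : ‖x‖ ≤ C :=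
  let φ : periodicSubmodule N := x
  (BoundedContinuousFunction.norm_le (f := φ.1) hC).2 h

lemma norm_sub_projP_le {b c : ℝ} (hc : c ≠ 0) {N k : ℕ} [NeZero N]
    (w : Module.Basis (Fin k) ℝ (leftKer b c N)) (x : PeriodicSpace N) :
    ‖x - projP b c N x‖ ≤ solutionOpNorm hc w * ‖linearOp b c N x‖ := by
  rw [← solutionOp_linearOp hc w]
  exact (LinearMap.toContinuousLinearMap (solutionOp hc w)).le_opNorm _

/-- The kernel component of a periodic solution contributes to `y` a constant, which is zero
without resonance; the rest is bounded by `‖M_p (I - Q)‖` times the bound of the nonlinearity. -/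
lemma exists_abs_sub_le {N k : ℕ} [NeZero N] (hodd : Odd N) {b c : ℝ} (hc : c ≠ 0)
    (w : Module.Basis (Fin k) ℝ (leftKer b c N))
    (hu : 1 + b + c ≠ 0 → IsUnit (1 - companionCLM b c ^ N))
    {y f : ℕ → ℝ} {δ : ℝ} (hy : ∀ t, y (t + N) = y t)
    (heq : ∀ t, y (t + 2) + b * y (t + 1) + c * y t = f t) (hδ0 : 0 ≤ δ) (hδ : ∀ t, |f t| ≤ δ) :
    ∃ α : ℝ, (1 + b + c ≠ 0 → α = 0) ∧ ∀ t, |y t - α| ≤ solutionOpNorm hc w * δ := by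
  set x : PeriodicSpace N := PeriodicSpace.mk (fun t => !₂[y t, y (t + 1)]) (fun t => by
    simp only [show t + N + 1 = t + 1 + N by ring, hy]) with hx
  have hxt : ∀ t, x t = !₂[y t, y (t + 1)] := fun t => rfl
  have hL : ∀ t, linearOp b c N x t = !₂[0, f t] := by
    intro t
    rw [linearOp_apply, ← pow_one (companion b c), ← companionCLM_pow_apply, pow_one,
      companionCLM_apply, hxt, hxt]
    ext i
    fin_cases i
    · simp
    · simp [← heq t]
      ring
  have hLn : ‖linearOp b c N x‖ ≤ δ := PeriodicSpace.norm_le hδ0 fun t => by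
    rw [hL t]
    simpa [EuclideanSpace.norm_eq, Fin.sum_univ_two, Real.sqrt_sq_eq_abs] using hδ t
  set v := (rightKer b c N).starProjection (x 0) with hv
  have hvm : v ∈ rightKer b c N := Submodule.starProjection_apply_mem _ _
  have hP : ∀ t, projP b c N x t = (companionCLM b c ^ t) v := fun t => by
    rw [projP_apply, companionCLM_pow_apply]
  have hPv : ∀ t, projP b c N x t 0 = v 0 := by
    intro t
    rw [hP]
    by_cases hbc : 1 + b + c = 0
    · have h1 := apply_eq_of_mem_rightKer hodd hbc hvm
      have h2 : v = !₂[v 0, v 0 + 0] := by ext i; fin_cases i <;> simp [h1]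
      rw [h2, companionCLM_pow_apply_of_resonance hbc]
      simp
    · have h1 : v = 0 := eq_zero_of_mem_rightKer (hu hbc) hvm
      simp [h1]
  refine ⟨v 0, fun hbc => ?_, fun t => ?_⟩
  · rw [eq_zero_of_mem_rightKer (hu hbc) hvm]; rfl
  · have h1 := (abs_apply_le_norm ((x - projP b c N x) t) 0).trans
      ((PeriodicSpace.norm_apply_le _ t).trans ((norm_sub_projP_le hc w x).trans
        (mul_le_mul_of_nonneg_left hLn (norm_nonneg _))))
    have h2 : (x - projP b c N x) t 0 = y t - v 0 := by
      rw [← hPv t]; rfl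
    rwa [h2] at h1

/-! ### The truncated equation -/

/-- In resonance, summing the equation over a period gives `∑ f(t) = (1 + b + c) ∑ y(t) = 0`. -/
lemma sum_eq_zero_of_resonance {N : ℕ} {b c : ℝ} (hbc : 1 + b + c = 0) {y f : ℕ → ℝ}
    (hy : ∀ t, y (t + N) = y t) (heq : ∀ t, y (t + 2) + b * y (t + 1) + c * y t = f t) :
    ∑ t ∈ Finset.range N, f t = 0 := by
  have h : ∀ t, f t = (y (t + 1 + 1) - c * y (t + 1)) - (y (t + 1) - c * y t) := fun t => by
    rw [← heq t]
    linear_combination y (t + 1) * hbc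
  simp only [h]
  rw [Finset.sum_range_sub (fun t => y (t + 1) - c * y t)]
  have h0 := hy 0
  have h1 := hy 1
  rw [zero_add] at h0
  rw [add_comm N 1, h0, h1]
  ring

end PeriodicDifference

theorem theorem3p1 (N : ℕ) [NeZero N] (hN : 1 < N) (hodd : Odd N)
    (b c : ℝ) (hc : c ≠ 0)
    (g : ℕ → ℝ → ℝ) (hg : Continuous (fun p : ℕ × ℝ => g p.1 p.2))
    (hper : ∀ t x, g (t + N) x = g t x)
    (k : ℕ) (w : Module.Basis (Fin k) ℝ (PeriodicDifference.leftKer b c N))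
    (r z δ : ℝ) (hr : 0 < r) (hz : 0 < z) (hδ : 0 < δ)
    (C1 : ∀ t, ∀ x ∈ Set.Icc (-(2 * r)) (2 * r), |g t x| ≤ δ)
    (C2 : ∀ t x, z < |x| → 0 < x * g t x)
    (C3 : z + PeriodicDifference.solutionOpNorm (N := N) hc w * δ < r)
    (C4 : (∃ m : ℤ, (N : ℝ) * Real.arccos (-b / 2) = m * (2 * Real.pi)) → c ≠ 1 ∨ 2 ≤ |b|) :
    ∃ y : ℕ → ℝ, (∀ t, y (t + N) = y t) ∧
      ∀ t, y (t + 2) + b * y (t + 1) + c * y t = g t (y t) := by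
  open PeriodicDifference in
  have hu := fun hbc => isUnit_one_sub_companionCLM_pow (NeZero.ne N) hodd (b := b) (c := c) hbc C4
  have hM : 0 ≤ solutionOpNorm (N := N) hc w * δ := mul_nonneg (norm_nonneg _) hδ.le
  have h2r : -(2 * r) ≤ 2 * r := by linarith
  -- the equation is solved first with `g` frozen outside `[-2r, 2r]`
  set h : ℕ → ℝ → ℝ := fun t x => g t (Set.projIcc (-(2 * r)) (2 * r) h2r x) with hh
  have hgc : ∀ t, Continuous (g t) := fun t => hg.comp (Continuous.prodMk_right t)
  have hhc : ∀ t, Continuous (h t) := fun t => (hgc t).comp (by fun_prop)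
  have hhper : ∀ t x, h (t + N) x = h t x := fun t x => hper t _
  have hhδ : ∀ t x, |h t x| ≤ δ := fun t x => C1 t _ (Subtype.property _)
  have hpos : ∀ t x, z < x → 0 < h t x := by
    intro t x hx
    have h1 : z < (Set.projIcc (-(2 * r)) (2 * r) h2r x : ℝ) := by
      rw [Set.coe_projIcc, lt_max_iff, lt_min_iff]
      right; constructor <;> linarith
    exact pos_of_mul_pos_right (C2 t _ (lt_abs.2 (Or.inl h1))) (by linarith)
  have hneg : ∀ t x, x < -z → h t x < 0 := by
    intro t x hx
    have h1 : (Set.projIcc (-(2 * r)) (2 * r) h2r x : ℝ) < -z := by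
      rw [Set.coe_projIcc, max_lt_iff, min_lt_iff]
      constructor
      · linarith
      · right; linarith
    have h2 := C2 t _ (lt_abs.2 (Or.inr (by linarith : z < -_)))
    exact neg_of_mul_pos_right h2 (by linarith)
  obtain ⟨y, hy, heq⟩ : ∃ y : ℕ → ℝ, (∀ t, y (t + N) = y t) ∧
      ∀ t, y (t + 2) + b * y (t + 1) + c * y t = h t (y t) := by
    by_cases hbc : 1 + b + c = 0
    · exact exists_periodic_of_resonance (NeZero.pos N) hodd hbc hhc hhper hhδ hneg hpos
    · exact exists_periodic_of_isUnit hhc hhper hhδ (hu hbc)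
  obtain ⟨α, hα0, hα⟩ := exists_abs_sub_le hodd hc w hu hy heq hδ.le (fun t => hhδ t _)
  have hαr : |α| < r := by
    by_cases hbc : 1 + b + c = 0
    · have hsum := sum_eq_zero_of_resonance hbc hy heq
      have hne : (Finset.range N).Nonempty := Finset.nonempty_range_iff.2 (NeZero.ne N)
      by_contra! hge
      rcases le_abs'.1 hge with hge | hge
      · exact (Finset.sum_neg (fun t _ => hneg t (y t) (by
          have := abs_le.1 (hα t); linarith)) hne).ne hsum
      · exact (Finset.sum_pos (fun t _ => hpos t (y t) (by
          have := abs_le.1 (hα t); linarith)) hne).ne' hsum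
    · rw [hα0 hbc, abs_zero]; exact hr
  refine ⟨y, hy, fun t => ?_⟩
  have hmem : y t ∈ Set.Icc (-(2 * r)) (2 * r) := by
    have h1 := abs_le.1 (hα t)
    have h2 := abs_lt.1 hαr
    constructor <;> linarith
  rw [heq t, hh]
  simp only [Set.projIcc_of_mem h2r hmem]
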